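/- A real is an infinite binary sequence $X \in \{0,1\}^{\mathbb N}$, and $X\restriction_n$ denotes its first $n$ bits. A Turing functional $\Phi$ is a partial computable function $(\rho,n)\mapsto\Phi^{\rho}(n)$ of a finite binary string $\rho$ and a number $n$, with values in $\mathbb N$, such that if $\Phi^{\rho_0}(n)$ is defined and $\rho_1$ extends $\rho_0$, then $\Phi^{\rho_1}(n)$ is defined and equals $\Phi^{\rho_0}(n)$. A sequence $(r_n)_{n\in\mathbb N}$ of natural numbers is pointedly $X$-computable if it is strictly increasing and there is a Turing functional $\Phi$ such that, for every $n$, $\Phi^{X\restriction_{r_n}}(n)$ is defined and equals $r_n$. A real $X$ is Martin-Löf random if $X\notin\bigcap_n\bigcup_{\sigma\in V_n}[\sigma]$ for every uniformly computably enumerable sequence $(V_n)$ of sets of strings such that $\bigcup_{\sigma\in V_n}[\sigma]$ has uniform measure at most $2^{-n}$ for every $n$, where $[\sigma]$ is the set of reals that extend $\sigma$. For a prefix-free machine $M$ (a partial computable function from strings to strings with prefix-free domain), $K_M(x)$ is the length of a shortest $\sigma$ with $M(\sigma)=x$ ($\infty$ if there is none), and $K=K_U$ for an optimal prefix-free machine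 $U$, that is, a prefix-free machine such that for every prefix-free machine $M$ there is a constant $d$ with $K_U(x)\le K_M(x)+d$ for all strings $x$. Theorem 1 (Randomness condition). Let $U$ be any optimal prefix-free machine and $K=K_U$. Let $X$ be a real and let $(r_n)$ be a pointedly $X$-computable sequence. Then $X$ is Martin-Löf random if and only if there is a constant $c$ such that $K(X\restriction_{r_n})>r_n-c$ for all $n$. -/

import Mathlib

open scoped ENNReal

/-- The initial segment `X ↾ n = X(0) ⋯ X(n-1)` of a real `X`, where a real is an infinite
binary sequence. -/
def initSeg (X : ℕ → Bool) (n : ℕ) : List Bool := (List.range n).map X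

/-- The basic open set of all reals that extend the binary string `σ`. -/
def cylinder (σ : List Bool) : Set (ℕ → Bool) := {X | initSeg X σ.length = σ}

/-- The uniform (fair coin) measure on Cantor space. -/
noncomputable def coinMeasure : MeasureTheory.Measure (ℕ → Bool) :=
  MeasureTheory.Measure.infinitePi fun _ : ℕ => (PMF.uniformOfFintype Bool).toMeasure

/-- A Martin-Löf test: a uniformly computably enumerable sequence of sets of strings, the `n`-th
of which generates an open set of measure at most `2⁻ⁿ`. -/
def IsMLTest (V : ℕ → Set (List Bool)) : Prop :=
  REPred (fun a : ℕ × List Bool => a.2 ∈ V a.1) ∧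
    ∀ n, coinMeasure (⋃ σ ∈ V n, cylinder σ) ≤ (2⁻¹ : ℝ≥0∞) ^ n

/-- A real is Martin-Löf random if it passes every Martin-Löf test. -/
def IsMLRandom (X : ℕ → Bool) : Prop :=
  ∀ V : ℕ → Set (List Bool), IsMLTest V → X ∉ ⋂ n, ⋃ σ ∈ V n, cylinder σ

/-- A prefix-free machine: a partial computable function from strings to strings such that no
string in its domain is a proper prefix of another one. -/
structure IsPrefixFreeMachine (M : List Bool →. List Bool) : Prop where
  partrec : Partrec M
  prefixFree : ∀ σ τ, (M σ).Dom → (M τ).Dom → σ <+: τ → σ = τ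

/-- The complexity `K_M(x)` of a string `x` with respect to a machine `M`: the length of a shortest
`M`-description of `x`, and `⊤` if there is none. -/
noncomputable def machineComplexity (M : List Bool →. List Bool) (x : List Bool) : ℕ∞ :=
  sInf ((fun σ : List Bool => (σ.length : ℕ∞)) '' {σ | x ∈ M σ})

/-- An optimal (universal) prefix-free machine `U`; the prefix-free complexity `K` is
`machineComplexity U`, which depends on the choice of `U` only up to an additive constant. -/
structure IsOptimalPrefixFreeMachine (U : List Bool →. List Bool) : Prop where
  isPrefixFreeMachine : IsPrefixFreeMachine U
  optimal : ∀ M, IsPrefixFreeMachine M →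
    ∃ d : ℕ, ∀ x, machineComplexity U x ≤ machineComplexity M x + d

/-- A Turing functional: a partial computable function of a finite oracle `ρ` and a number `n`
such that a convergent computation stays the same when the oracle is extended. -/
structure IsTuringFunctional (Φ : List Bool → ℕ →. ℕ) : Prop where
  partrec : Partrec₂ Φ
  consistent : ∀ ρ₀ ρ₁ n m, ρ₀ <+: ρ₁ → m ∈ Φ ρ₀ n → m ∈ Φ ρ₁ n

/-- `(r n)` is pointedly `X`-computable: it is strictly increasing and some Turing functional
computes each `r n` from the first `r n` bits of `X`. -/
def IsPointedlyComputable (X : ℕ → Bool) (r : ℕ → ℕ) : Prop :=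
  StrictMono r ∧ ∃ Φ, IsTuringFunctional Φ ∧ ∀ n, r n ∈ Φ (initSeg X (r n)) n

/-! Randomness gives the bound for all initial segments: the strings that `U` compresses by `c` bits
form a Martin-Löf test, by Kraft's inequality (`isMLTest_compressible`).

For the converse, suppose `X` fails a test `V`. Inside each `V k` lies a prefix-free r.e. set
`pointedCover` that contains some `X ↾ r n`. A string `ρ` first finds, among its own prefixes, a
witness for `V k` with code `m`, then has to have length `Φ^ρ(m)`. Both `m` and that length are
already fixed by any shorter member below `ρ`, so two comparable members coincide. Hence the weight
of the cover is the measure of an open subset of `V k`. Saving `k` bits on the cover at level `2k +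
2` costs total weight at most `1/2`, and `exists_prefixFreeMachine` turns these requests into
descriptions that violate the bound on `K (X ↾ r n)`. -/

/-! ### Recursively enumerable predicates. -/

section Computability

variable {α β : Type*} [Primcodable α] [Primcodable β]

theorem REPred.comp_computable {p : β → Prop} (hp : REPred p) {f : α → β} (hf : Computable f) :
    REPred fun a => p (f a) :=
  Partrec.comp hp hf

theorem REPred.and {p q : α → Prop} (hp : REPred p) (hq : REPred q) :
    REPred fun a => p a ∧ q a := by
  have h : Partrec fun a => (Part.assert (p a) fun _ => Part.some ()).bind
      fun _ => Part.assert (q a) fun _ => Part.some () :=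
    Partrec.bind hp (Partrec.to₂ (Partrec.comp hq Computable.fst))
  refine h.dom_re.of_eq fun a => ?_
  simp [Part.assert]

theorem REPred.of_computable {p : α → Bool} (hp : Computable p) : REPred fun a => p a = true :=
  ComputablePred.to_re (ComputablePred.computable_iff.2 ⟨p, hp, rfl⟩)

theorem REPred.exists_nat {s : α → ℕ → Bool} (hs : Computable₂ s) :
    REPred fun a => ∃ n, s a n = true := by
  have h : Partrec fun a => Nat.rfind fun n => Part.some (s a n) := Partrec.rfind hs.partrec₂
  refine h.dom_re.of_eq fun a => ?_
  exact Nat.rfind_dom'.trans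
    ⟨fun ⟨n, hn, _⟩ => ⟨n, (Part.mem_some_iff.1 hn).symm⟩,
      fun ⟨n, hn⟩ => ⟨n, Part.mem_some_iff.2 hn.symm, fun _ => trivial⟩⟩

/-- A recursively enumerable predicate is the increasing union of uniformly computable stages,
the first of which is empty. -/
theorem REPred.exists_stages {p : α → Prop} (hp : REPred p) :
    ∃ s : ℕ → α → Bool, Computable₂ s ∧ (∀ a, s 0 a = false) ∧
      (∀ a t t', t ≤ t' → s t a = true → s t' a = true) ∧ ∀ a, p a ↔ ∃ t, s t a = true := by
  obtain ⟨c, hc⟩ := Nat.Partrec.Code.exists_code.1 hp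
  refine ⟨fun t a => (Nat.Partrec.Code.evaln t c (Encodable.encode a)).isSome, ?_, ?_, ?_, ?_⟩
  · exact Computable₂.mk (Primrec.option_isSome.to_comp.comp
      (Nat.Partrec.Code.primrec_evaln.to_comp.comp
        (Computable.pair (Computable.pair Computable.fst (Computable.const c))
          (Computable.encode.comp Computable.snd))))
  · intro a
    simp [Nat.Partrec.Code.evaln]
  · intro a t t' htt' h
    obtain ⟨x, hx⟩ := Option.isSome_iff_exists.1 h
    exact Option.isSome_iff_exists.2 ⟨x, Nat.Partrec.Code.evaln_mono htt' hx⟩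
  · intro a
    have h : p a ↔ (c.eval (Encodable.encode a)).Dom := by
      rw [hc]
      simp [Part.assert]
    rw [h, Part.dom_iff_mem]
    simp_rw [Nat.Partrec.Code.evaln_complete, Option.isSome_iff_exists]
    exact exists_comm

theorem REPred.exists {p : α × β → Prop} (hp : REPred p) : REPred fun a => ∃ b, p (a, b) := by
  obtain ⟨s, hs, -, -, hsp⟩ := hp.exists_stages
  have h : Computable₂ fun (a : α) (n : ℕ) =>
      ((Encodable.decode (α := β) n.unpair.2).map fun b => s n.unpair.1 (a, b)).getD false := by
    have hn : Computable fun q : α × ℕ => q.2.unpair := Computable.unpair.comp Computable.snd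
    refine Computable₂.mk (Computable.option_getD (Computable.option_map
      (Computable.decode.comp (Computable.snd.comp hn)) ?_) (Computable.const false))
    exact Computable₂.mk (hs.comp (Computable.fst.comp (hn.comp Computable.fst))
      (Computable.pair (Computable.fst.comp Computable.fst) Computable.snd))
  refine (REPred.exists_nat h).of_eq fun a => ?_
  constructor
  · rintro ⟨n, hn⟩
    cases hd : (Encodable.decode n.unpair.2 : Option β) with
    | none => simp [hd] at hn
    | some b => exact ⟨b, (hsp _).2 ⟨n.unpair.1, by simpa [hd] using hn⟩⟩
  · rintro ⟨b, hb⟩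
    obtain ⟨t, ht⟩ := (hsp _).1 hb
    exact ⟨Nat.pair t (Encodable.encode b), by simp [ht]⟩

theorem Partrec.graph_re [DecidableEq β] {f : α →. β} (hf : Partrec f) :
    REPred fun x : α × β => x.2 ∈ f x.1 := by
  have hg : Partrec₂ fun (x : α × β) (b : β) => Part.assert (b = x.2) fun _ => Part.some () := by
    have h : REPred fun q : β × β => q.1 = q.2 :=
      (REPred.of_computable (p := fun q => decide (q.1 = q.2))
        (Primrec.eq.decide.to_comp.comp Computable.fst Computable.snd)).of_eq
        fun q => decide_eq_true_iff
    exact h.comp_computable (Computable.pair Computable.snd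
      (Computable.snd.comp Computable.fst))
  have h := Partrec.bind (hf.comp (Computable.fst (β := β))) hg
  refine h.dom_re.of_eq fun x => ?_
  simp [Part.dom_iff_mem, Part.assert]

/-- A recursively enumerable set has a computable enumeration without repetitions. -/
theorem REPred.exists_enumeration {p : α → Prop} (hp : REPred p) :
    ∃ f : ℕ → Option α, Computable f ∧ (∀ m n a, f m = some a → f n = some a → m = n) ∧
      ∀ a, p a ↔ ∃ n, f n = some a := by
  obtain ⟨s, hs, hs0, hmono, hsp⟩ := hp.exists_stages
  -- Position `(t, code of a)` emits `a` only if `a` enters at stage `t + 1`. `decode₂` accepts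
  -- nothing but the canonical code, so there are no repetitions.
  have hf : ∀ (n : ℕ) (a : α), ((Encodable.decode₂ α n.unpair.2).bind fun a =>
      bif s (n.unpair.1 + 1) a && !s n.unpair.1 a then some a else none) = some a ↔
      Encodable.encode a = n.unpair.2 ∧ s (n.unpair.1 + 1) a = true ∧ s n.unpair.1 a = false := by
    intro n a
    rw [Option.bind_eq_some_iff]
    constructor
    · rintro ⟨b, hb, h⟩
      rw [Encodable.decode₂_eq_some] at hb
      cases h1 : s (n.unpair.1 + 1) b <;> cases h2 : s n.unpair.1 b <;> simp [h1, h2] at h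
      subst h
      exact ⟨hb, h1, h2⟩
    · rintro ⟨hb, h1, h2⟩
      exact ⟨a, Encodable.decode₂_eq_some.2 hb, by simp [h1, h2]⟩
  refine ⟨fun n => (Encodable.decode₂ α n.unpair.2).bind fun a =>
      bif s (n.unpair.1 + 1) a && !s n.unpair.1 a then some a else none, ?_, ?_, ?_⟩
  · refine Computable.option_bind
      (Primrec.decode₂.to_comp.comp (Computable.snd.comp Computable.unpair)) ?_
    have ht : Computable fun q : ℕ × α => q.1.unpair.1 :=
      Computable.fst.comp (Computable.unpair.comp Computable.fst)
    exact Computable₂.mk (Computable.cond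
      (Primrec.and.to_comp.comp (hs.comp (Computable.succ.comp ht) Computable.snd)
        (Primrec.not.to_comp.comp (hs.comp ht Computable.snd)))
      (Computable.option_some.comp Computable.snd) (Computable.const none))
  · intro m n a hm hn
    obtain ⟨hm, hm1, hm0⟩ := (hf m a).1 hm
    obtain ⟨hn, hn1, hn0⟩ := (hf n a).1 hn
    have h1 : m.unpair.1 = n.unpair.1 := by
      rcases lt_trichotomy m.unpair.1 n.unpair.1 with h | h | h
      · simp [hmono a _ _ h hm1] at hn0
      · exact h
      · simp [hmono a _ _ h hn1] at hm0
    rw [← Nat.pair_unpair m, ← Nat.pair_unpair n, h1, ← hm, ← hn]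
  · intro a
    rw [hsp]
    constructor
    · intro h
      classical
      -- The empty stage `0` guarantees that the stage of entry has a predecessor.
      obtain ⟨t, ht⟩ : ∃ t, Nat.find h = t + 1 := by
        refine Nat.exists_eq_succ_of_ne_zero fun h0 => ?_
        have := Nat.find_spec h
        simp [h0, hs0] at this
      refine ⟨Nat.pair t (Encodable.encode a), (hf _ a).2 ⟨by simp, ?_, ?_⟩⟩
      · rw [Nat.unpair_pair, ← ht]
        exact Nat.find_spec h
      · have := Nat.find_min h (m := t) (by omega)
        simpa using this
    · rintro ⟨n, hn⟩
      exact ⟨_, ((hf n a).1 hn).2.1⟩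

end Computability

/-! ### Measure of cylinders and Kraft's inequality. -/

section Cylinders

@[simp]
theorem length_initSeg (X : ℕ → Bool) (n : ℕ) : (initSeg X n).length = n := by
  simp [initSeg]

theorem take_initSeg (X : ℕ → Bool) {m n : ℕ} (h : m ≤ n) :
    (initSeg X n).take m = initSeg X m := by
  simp [initSeg, ← List.map_take, List.take_range, h]

theorem initSeg_prefix (X : ℕ → Bool) {m n : ℕ} (h : m ≤ n) : initSeg X m <+: initSeg X n :=
  take_initSeg X h ▸ List.take_prefix _ _

theorem initSeg_mem_of_mem_cylinder {X : ℕ → Bool} {σ : List Bool} (h : X ∈ cylinder σ) :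
    initSeg X σ.length = σ := h

theorem mem_cylinder_initSeg (X : ℕ → Bool) (n : ℕ) : X ∈ cylinder (initSeg X n) := by
  simp [cylinder]

theorem cylinder_anti {σ τ : List Bool} (h : σ <+: τ) : cylinder τ ⊆ cylinder σ := by
  intro X hX
  have hX : initSeg X τ.length = τ := hX
  change initSeg X σ.length = σ
  rw [← take_initSeg X h.length_le, hX]
  exact (List.prefix_iff_eq_take.1 h).symm

theorem cylinder_eq_pi (σ : List Bool) :
    cylinder σ = Set.pi (Finset.range σ.length) fun i => {σ.getD i false} := by
  ext X
  simp only [cylinder, Set.mem_ofPred_eq, Set.mem_pi, Set.mem_singleton_iff, Finset.coe_range,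
    Set.mem_Iio]
  constructor
  · intro h i hi
    rw [← h]
    simp [initSeg, hi]
  · intro h
    refine List.ext_getElem (by simp) fun i h1 h2 => ?_
    simp [initSeg, h i h2, h2]

theorem measurableSet_cylinder (σ : List Bool) : MeasurableSet (cylinder σ) := by
  rw [cylinder_eq_pi]
  exact MeasurableSet.pi (Finset.countable_toSet _) fun i _ => measurableSet_singleton _

instance : MeasureTheory.IsProbabilityMeasure coinMeasure := by
  unfold coinMeasure
  infer_instance

theorem coinMeasure_cylinder (σ : List Bool) : coinMeasure (cylinder σ) = 2⁻¹ ^ σ.length := by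
  rw [cylinder_eq_pi, coinMeasure, MeasureTheory.Measure.infinitePi_pi]
  · simp
  · exact fun i _ => measurableSet_singleton _

theorem disjoint_cylinder {σ τ : List Bool} (h₁ : ¬ σ <+: τ) (h₂ : ¬ τ <+: σ) :
    Disjoint (cylinder σ) (cylinder τ) := by
  refine Set.disjoint_left.2 fun X hσ hτ => ?_
  rcases le_total σ.length τ.length with h | h
  · have := initSeg_prefix X h
    rw [initSeg_mem_of_mem_cylinder hσ, initSeg_mem_of_mem_cylinder hτ] at this
    exact h₁ this
  · have := initSeg_prefix X h
    rw [initSeg_mem_of_mem_cylinder hσ, initSeg_mem_of_mem_cylinder hτ] at this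
    exact h₂ this

theorem tsum_prefixFree_eq_coinMeasure {A : Set (List Bool)}
    (hA : ∀ σ ∈ A, ∀ τ ∈ A, σ <+: τ → σ = τ) :
    ∑' σ : A, (2⁻¹ : ℝ≥0∞) ^ σ.1.length = coinMeasure (⋃ σ ∈ A, cylinder σ) := by
  rw [MeasureTheory.measure_biUnion (Set.to_countable A) _ fun σ _ => measurableSet_cylinder σ]
  · simp_rw [coinMeasure_cylinder]
  · intro σ hσ τ hτ hne
    exact disjoint_cylinder (fun h => hne (hA σ hσ τ hτ h)) fun h => hne (hA τ hτ σ hσ h).symm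

/-- **Kraft's inequality**. -/
theorem tsum_prefixFree_le_one {A : Set (List Bool)}
    (hA : ∀ σ ∈ A, ∀ τ ∈ A, σ <+: τ → σ = τ) :
    ∑' σ : A, (2⁻¹ : ℝ≥0∞) ^ σ.1.length ≤ 1 :=
  (tsum_prefixFree_eq_coinMeasure hA).trans_le MeasureTheory.prob_le_one

theorem coinMeasure_biUnion_cylinder_le (A : Set (List Bool)) :
    coinMeasure (⋃ σ ∈ A, cylinder σ) ≤ ∑' σ : A, (2⁻¹ : ℝ≥0∞) ^ σ.1.length := by
  refine (MeasureTheory.measure_biUnion_le _ (Set.to_countable A) _).trans_eq ?_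
  simp_rw [coinMeasure_cylinder]

end Cylinders

/-! ### Machine existence via reserved dyadic intervals. -/

section MachineExistence

/-- The number whose binary expansion, most significant bit first, is the given string. -/
def binVal (σ : List Bool) : ℕ := σ.foldl (fun a b => 2 * a + bif b then 1 else 0) 0

theorem computable_binVal : Computable binVal :=
  (Primrec.list_foldl Primrec.id (Primrec.const 0) (Primrec.nat_add.comp
    (Primrec.nat_mul.comp (Primrec.const 2) (Primrec.fst.comp Primrec.snd))
    (Primrec.cond (Primrec.snd.comp Primrec.snd)
      (Primrec.const 1) (Primrec.const 0))).to₂).to_comp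

theorem binVal_concat (σ : List Bool) (b : Bool) :
    binVal (σ ++ [b]) = 2 * binVal σ + bif b then 1 else 0 := by
  simp [binVal]

/-- Expresses that the dyadic interval of an extension is nested in that of the string. -/
theorem binVal_append_bounds (σ ρ : List Bool) :
    binVal σ * 2 ^ ρ.length ≤ binVal (σ ++ ρ) ∧
      binVal (σ ++ ρ) + 1 ≤ (binVal σ + 1) * 2 ^ ρ.length := by
  induction ρ using List.reverseRecOn with
  | nil => simp
  | append_singleton ρ b ih =>
    rw [← List.append_assoc, binVal_concat, List.length_append, List.length_singleton, pow_succ]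
    cases b <;> simp only [cond_true, cond_false] <;> constructor <;> nlinarith [ih.1, ih.2]

theorem exists_binVal_eq (l v : ℕ) (hv : v < 2 ^ l) : ∃ σ, σ.length = l ∧ binVal σ = v := by
  induction l generalizing v with
  | zero => exact ⟨[], rfl, by simp [binVal]; omega⟩
  | succ l ih =>
    obtain ⟨σ, hσ, hv'⟩ := ih (v / 2) (by rw [pow_succ] at hv; omega)
    refine ⟨σ ++ [decide (v % 2 = 1)], by simp [hσ], ?_⟩
    rw [binVal_concat, hv']
    rcases Nat.mod_two_eq_zero_or_one v with h | h <;> simp [h] <;> omega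

theorem Computable.two_pow {α : Type*} [Primcodable α] {f : α → ℕ} (hf : Computable f) :
    Computable fun a => 2 ^ f a :=
  (Computable.nat_rec (h := fun _ x => x.2 * 2) hf (Computable.const 1)
    (Computable₂.mk (Primrec.nat_mul.to_comp.comp (Computable.snd.comp Computable.snd)
      (Computable.const 2)))).of_eq fun a => by
        induction f a with
        | zero => rfl
        | succ n ih => rw [pow_succ, ← ih]

/-- The numerator and denominator of the left endpoint of the dyadic interval that is reserved for
the `n`-th request, where a request of length `l` reserves an interval of length `2 * 2⁻ˡ`. -/
def reservation (f : ℕ → Option (ℕ × List Bool)) (n : ℕ) : ℕ × ℕ :=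
  Nat.rec (0, 1) (fun i s => Option.casesOn (f i) s fun q =>
    (s.1 * 2 ^ q.1 + 2 * s.2, s.2 * 2 ^ q.1)) n

/-- The position, at scale `2⁻ˡ`, of a dyadic interval inside the `n`-th reserved interval. -/
def codeVal (f : ℕ → Option (ℕ × List Bool)) (n l : ℕ) : ℕ :=
  (reservation f n).1 * 2 ^ l / (reservation f n).2 + 1

/-- The machine that answers each request `(l, ρ)` enumerated by `f` by mapping a string of length
`l` to `ρ`. -/
def requestMachine (f : ℕ → Option (ℕ × List Bool)) : List Bool →. List Bool := fun τ =>
  Nat.rfindOpt fun n => (f n).bind fun q =>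
    bif decide (τ.length = q.1) && decide (binVal τ = codeVal f n q.1) then some q.2 else none

variable {f : ℕ → Option (ℕ × List Bool)}

theorem computable_reservation (hf : Computable f) : Computable (reservation f) := by
  refine Computable.of_eq (Computable.nat_rec (f := id) (g := fun _ => ((0, 1) : ℕ × ℕ))
    (h := fun _ (x : ℕ × ℕ × ℕ) => Option.casesOn (f x.1) x.2 fun q =>
      (x.2.1 * 2 ^ q.1 + 2 * x.2.2, x.2.2 * 2 ^ q.1))
    Computable.id (Computable.const (0, 1)) (Computable₂.mk ?_)) fun _ => rfl
  refine Computable.option_casesOn (hf.comp (Computable.fst.comp Computable.snd))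
    (Computable.snd.comp Computable.snd) (Computable₂.mk ?_)
  have hs : Computable fun x : (ℕ × ℕ × ℕ × ℕ) × ℕ × List Bool => x.1.2.2 :=
    Computable.snd.comp (Computable.snd.comp Computable.fst)
  have hq : Computable fun x : (ℕ × ℕ × ℕ × ℕ) × ℕ × List Bool => 2 ^ x.2.1 :=
    Computable.two_pow (Computable.fst.comp Computable.snd)
  exact Computable.pair
    (Primrec.nat_add.to_comp.comp (Primrec.nat_mul.to_comp.comp (Computable.fst.comp hs) hq)
      (Primrec.nat_mul.to_comp.comp (Computable.const 2) (Computable.snd.comp hs)))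
    (Primrec.nat_mul.to_comp.comp (Computable.snd.comp hs) hq)

theorem computable_codeVal (hf : Computable f) : Computable₂ (codeVal f) := by
  have hs : Computable fun x : ℕ × ℕ => reservation f x.1 :=
    (computable_reservation hf).comp Computable.fst
  exact Computable₂.mk (Computable.succ.comp (Primrec.nat_div.to_comp.comp
    (Primrec.nat_mul.to_comp.comp (Computable.fst.comp hs) (Computable.two_pow Computable.snd))
    (Computable.snd.comp hs)))

theorem partrec_requestMachine (hf : Computable f) : Partrec (requestMachine f) := by
  refine Partrec.rfindOpt (Computable₂.mk ?_)
  refine Computable.option_bind (hf.comp Computable.snd) (Computable₂.mk ?_)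
  have hq : Computable fun x : (List Bool × ℕ) × ℕ × List Bool => x.2.1 :=
    Computable.fst.comp Computable.snd
  have hτ : Computable fun x : (List Bool × ℕ) × ℕ × List Bool => x.1.1 :=
    Computable.fst.comp Computable.fst
  refine Computable.cond (Primrec.and.to_comp.comp ?_ ?_)
    (Computable.option_some.comp (Computable.snd.comp Computable.snd)) (Computable.const none)
  · exact Primrec.eq.decide.to_comp.comp (Computable.list_length.comp hτ) hq
  · exact Primrec.eq.decide.to_comp.comp (computable_binVal.comp hτ)
      ((computable_codeVal hf).comp (Computable.snd.comp Computable.fst) hq)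

theorem exists_of_mem_requestMachine {τ ρ : List Bool} (h : ρ ∈ requestMachine f τ) :
    ∃ n, f n = some (τ.length, ρ) ∧ binVal τ = codeVal f n τ.length := by
  obtain ⟨n, hn⟩ := Nat.rfindOpt_spec h
  rw [Option.mem_def, Option.bind_eq_some_iff] at hn
  obtain ⟨⟨l, ρ'⟩, hq, h⟩ := hn
  by_cases h1 : τ.length = l <;> by_cases h2 : binVal τ = codeVal f n l <;> simp [h1, h2] at h
  subst h1 h
  exact ⟨n, hq, h2⟩

theorem requestMachine_dom {τ ρ : List Bool} {n : ℕ} (h1 : f n = some (τ.length, ρ))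
    (h2 : binVal τ = codeVal f n τ.length) : (requestMachine f τ).Dom :=
  Nat.rfindOpt_dom.2 ⟨n, ρ, by simp [h1, h2]⟩

/-- The real number that `reservation` represents. -/
noncomputable def reservationPoint (f : ℕ → Option (ℕ × List Bool)) (n : ℕ) : ℝ :=
  (reservation f n).1 / (reservation f n).2

/-- The measure `2⁻ˡ` that a request of length `l` asks for. -/
noncomputable def requestWeight (q : Option (ℕ × List Bool)) : ℝ≥0∞ :=
  q.elim 0 fun q => 2⁻¹ ^ q.1

theorem reservation_snd_pos (n : ℕ) : 0 < (reservation f n).2 := by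
  induction n with
  | zero => exact Nat.one_pos
  | succ n ih =>
    change 0 < (Option.casesOn (f n) (reservation f n) fun q => _ : ℕ × ℕ).2
    cases f n with
    | none => exact ih
    | some q => exact Nat.mul_pos ih (by positivity)

theorem reservationPoint_succ (n : ℕ) : reservationPoint f (n + 1) =
    reservationPoint f n + 2 * (requestWeight (f n)).toReal := by
  have hp : ((reservation f n).2 : ℝ) ≠ 0 := by exact_mod_cast (reservation_snd_pos n).ne'
  have h : reservation f (n + 1) = Option.casesOn (f n) (reservation f n) fun q =>
    ((reservation f n).1 * 2 ^ q.1 + 2 * (reservation f n).2, (reservation f n).2 * 2 ^ q.1) := rfl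
  rw [reservationPoint, reservationPoint, h]
  cases f n with
  | none => simp [requestWeight]
  | some q =>
    simp [requestWeight]
    field_simp

theorem reservationPoint_mono : Monotone (reservationPoint f) :=
  monotone_nat_of_le_succ fun n => by
    rw [reservationPoint_succ]
    linarith [(requestWeight (f n)).toReal_nonneg]

theorem reservationPoint_eq_sum (n : ℕ) :
    reservationPoint f n = 2 * ∑ i ∈ Finset.range n, (requestWeight (f i)).toReal := by
  induction n with
  | zero => simp [reservationPoint, reservation]
  | succ n ih => rw [reservationPoint_succ, ih, Finset.sum_range_succ]; ring

theorem requestWeight_ne_top (q : Option (ℕ × List Bool)) : requestWeight q ≠ ∞ := by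
  cases q <;> simp [requestWeight]

theorem reservationPoint_le_one (h : ∑' n, requestWeight (f n) ≤ 2⁻¹) (n : ℕ) :
    reservationPoint f n ≤ 1 := by
  rw [reservationPoint_eq_sum, ← ENNReal.toReal_sum fun i _ => requestWeight_ne_top _]
  have := ENNReal.toReal_mono (by simp)
    ((ENNReal.sum_le_tsum (Finset.range n)).trans h)
  rw [ENNReal.toReal_inv, ENNReal.toReal_ofNat] at this
  linarith

/-- An interval of length `2 * 2⁻ˡ` contains an aligned dyadic interval of length `2⁻ˡ` wherever it
starts: round the left endpoint down to the grid and add one step. This is why a request reserves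
twice its weight, and why `1/2` bounds the total. -/
theorem codeVal_bounds {n l : ℕ} {ρ : List Bool} (h : f n = some (l, ρ)) :
    reservationPoint f n < codeVal f n l / 2 ^ l ∧
      (codeVal f n l + 1) / 2 ^ l ≤ reservationPoint f (n + 1) := by
  have hp := reservation_snd_pos (f := f) n
  have hp' : (0 : ℝ) < (reservation f n).2 := by exact_mod_cast hp
  have hl : (0 : ℝ) < 2 ^ l := by positivity
  have h1 := Nat.lt_succ_iff.2 (le_refl ((reservation f n).1 * 2 ^ l / (reservation f n).2))
  rw [Nat.div_lt_iff_lt_mul hp] at h1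
  have h2 := Nat.div_mul_le_self ((reservation f n).1 * 2 ^ l) (reservation f n).2
  rw [reservationPoint_succ, h]
  simp only [requestWeight, Option.elim, reservationPoint, codeVal, ENNReal.toReal_pow,
    ENNReal.toReal_inv, ENNReal.toReal_ofNat, inv_pow]
  generalize (reservation f n).1 * 2 ^ l / (reservation f n).2 = v at *
  have h1' : ((reservation f n).1 : ℝ) * 2 ^ l < (v + 1) * (reservation f n).2 := by
    exact_mod_cast h1
  have h2' : (v : ℝ) * (reservation f n).2 ≤ (reservation f n).1 * 2 ^ l := by exact_mod_cast h2
  push_cast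
  constructor
  · rw [div_lt_div_iff₀ hp' hl]
    exact h1'
  · have h3 : (v : ℝ) / 2 ^ l ≤ (reservation f n).1 / (reservation f n).2 := by
      rw [div_le_div_iff₀ hl hp']
      exact h2'
    have h4 : ((v : ℝ) + 1 + 1) / 2 ^ l = v / 2 ^ l + 2 * (2 ^ l)⁻¹ := by field_simp; ring
    linarith

/-- The interval of `τ` is nested in that of `σ`, whereas different requests have reserved intervals
without common interior. No weight bound is needed. -/
theorem eq_of_prefix_of_codeVal {m n : ℕ} {σ τ ρ ρ' : List Bool} (hστ : σ <+: τ)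
    (hm : f m = some (σ.length, ρ)) (hσ : binVal σ = codeVal f m σ.length)
    (hn : f n = some (τ.length, ρ')) (hτ : binVal τ = codeVal f n τ.length) : m = n := by
  obtain ⟨m1, m2⟩ := codeVal_bounds hm
  obtain ⟨n1, n2⟩ := codeVal_bounds hn
  rw [← hσ] at m1 m2
  rw [← hτ] at n1 n2
  obtain ⟨π, rfl⟩ := hστ
  obtain ⟨b1, b2⟩ := binVal_append_bounds σ π
  have e : (2 : ℝ) ^ (σ ++ π).length = 2 ^ σ.length * 2 ^ π.length := by
    rw [List.length_append, pow_add]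
  have b1' : (binVal σ : ℝ) / 2 ^ σ.length ≤ binVal (σ ++ π) / 2 ^ (σ ++ π).length := by
    rw [e, ← div_div, le_div_iff₀ (by positivity), div_mul_eq_mul_div]
    gcongr
    exact_mod_cast b1
  have b2' : ((binVal (σ ++ π) : ℝ) + 1) / 2 ^ (σ ++ π).length ≤
      (binVal σ + 1) / 2 ^ σ.length := by
    rw [e, ← div_div, div_le_iff₀ (by positivity), div_mul_eq_mul_div]
    gcongr
    exact_mod_cast b2
  have s1 : (binVal σ : ℝ) / 2 ^ σ.length < (binVal σ + 1) / 2 ^ σ.length := by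
    gcongr
    linarith
  have s2 : (binVal (σ ++ π) : ℝ) / 2 ^ (σ ++ π).length <
      (binVal (σ ++ π) + 1) / 2 ^ (σ ++ π).length := by
    gcongr
    linarith
  rcases lt_trichotomy m n with h | h | h
  · linarith [reservationPoint_mono (f := f) (Nat.succ_le_of_lt h)]
  · exact h
  · linarith [reservationPoint_mono (f := f) (Nat.succ_le_of_lt h)]

theorem isPrefixFreeMachine_requestMachine (hf : Computable f) :
    IsPrefixFreeMachine (requestMachine f) where
  partrec := partrec_requestMachine hf
  prefixFree σ τ hσ hτ h := by
    obtain ⟨m, hm, hσ⟩ := exists_of_mem_requestMachine (Part.get_mem hσ)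
    obtain ⟨n, hn, hτ⟩ := exists_of_mem_requestMachine (Part.get_mem hτ)
    obtain rfl := eq_of_prefix_of_codeVal h hm hσ hn hτ
    rw [hm] at hn
    exact h.eq_of_length (congrArg Prod.fst (Option.some.inj hn))

theorem exists_mem_requestMachine (h : ∑' n, requestWeight (f n) ≤ 2⁻¹) {n l : ℕ} {ρ : List Bool}
    (hn : f n = some (l, ρ)) : ∃ τ, τ.length = l ∧ ρ ∈ requestMachine f τ := by
  -- Only here does the weight bound enter: it keeps all reservations inside `[0, 1]`.
  have hlt : codeVal f n l < 2 ^ l := by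
    have h1 := (codeVal_bounds hn).2.trans (reservationPoint_le_one h _)
    rw [div_le_one (by positivity)] at h1
    exact_mod_cast h1
  obtain ⟨τ, rfl, hτ⟩ := exists_binVal_eq l _ hlt
  refine ⟨τ, rfl, ?_⟩
  -- The search might stop at another request; equal code strings force equal indices.
  obtain ⟨ρ', hρ'⟩ := Part.dom_iff_mem.1 (requestMachine_dom hn hτ)
  obtain ⟨m, hm, hτ'⟩ := exists_of_mem_requestMachine hρ'
  obtain rfl := eq_of_prefix_of_codeVal (List.prefix_refl τ) hm hτ' hn hτ
  rw [hm] at hn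
  obtain rfl : ρ' = ρ := congrArg Prod.snd (Option.some.inj hn)
  exact hρ'

theorem machineComplexity_le {M : List Bool →. List Bool} {τ ρ : List Bool} (h : ρ ∈ M τ) :
    machineComplexity M ρ ≤ τ.length :=
  sInf_le ⟨τ, h, rfl⟩

theorem exists_mem_of_machineComplexity_le {M : List Bool →. List Bool} {ρ : List Bool} {l : ℕ}
    (h : machineComplexity M ρ ≤ l) : ∃ τ, ρ ∈ M τ ∧ τ.length ≤ l := by
  have hne : ((fun σ : List Bool => (σ.length : ℕ∞)) '' {σ | ρ ∈ M σ}).Nonempty := by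
    by_contra hne
    rw [Set.not_nonempty_iff_eq_empty] at hne
    rw [machineComplexity, hne, sInf_empty] at h
    exact absurd h (by simp)
  obtain ⟨τ, hτ, he⟩ := csInf_mem hne
  refine ⟨τ, hτ, ?_⟩
  rw [machineComplexity, ← he] at h
  exact Nat.cast_le.1 h

/-- The **machine existence theorem**: a recursively enumerable set of requests `(l, ρ)` of total
weight at most `1/2` is answered by a prefix-free machine that describes each `ρ` with at most
`l` bits. -/
theorem exists_prefixFreeMachine {Q : Set (ℕ × List Bool)} (hQ : REPred fun q => q ∈ Q)
    (hw : ∑' q : Q, (2⁻¹ : ℝ≥0∞) ^ q.1.1 ≤ 2⁻¹) :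
    ∃ M, IsPrefixFreeMachine M ∧ ∀ l ρ, (l, ρ) ∈ Q → machineComplexity M ρ ≤ l := by
  obtain ⟨f, hf, hinj, hfQ⟩ := hQ.exists_enumeration
  refine ⟨requestMachine f, isPrefixFreeMachine_requestMachine hf, fun l ρ h => ?_⟩
  have hsum : ∑' n, requestWeight (f n) ≤ 2⁻¹ := by
    have hsupp : (Function.support fun n => requestWeight (f n)) ⊆ {n | (f n).isSome} := by
      intro n hn
      rw [Function.mem_support] at hn
      cases hfn : f n with
      | none => simp [hfn, requestWeight] at hn
      | some q => simp [hfn]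
    rw [← tsum_subtype_eq_of_support_subset hsupp]
    -- As `f` does not repeat, its total weight is at most that of `Q`.
    let g : {n | (f n).isSome} → Q := fun n =>
      ⟨(f n.1).get n.2, (hfQ _).2 ⟨n.1, (Option.some_get n.2).symm⟩⟩
    have hg : Function.Injective g := fun m n hmn => by
      have h := congrArg Subtype.val hmn
      refine Subtype.ext (hinj _ _ _ (Option.some_get m.2).symm ?_)
      rw [← Option.some_get n.2]
      exact congrArg some h.symm
    refine le_trans (le_of_eq ?_) ((ENNReal.tsum_comp_le_tsum_of_injective hg
      fun q : Q => (2⁻¹ : ℝ≥0∞) ^ q.1.1).trans hw)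
    refine tsum_congr fun n => ?_
    conv_lhs => rw [← Option.some_get n.2]
    rfl
  obtain ⟨n, hn⟩ := (hfQ _).1 h
  obtain ⟨τ, rfl, hτ⟩ := exists_mem_requestMachine hsum hn
  exact machineComplexity_le hτ

end MachineExistence

/-! ### Compressible strings as a Martin-Löf test. -/

section Deficiency

/-- The strings that `U` compresses by at least `c` bits. -/
def compressible (U : List Bool →. List Bool) (c : ℕ) : Set (List Bool) :=
  {σ | ∃ τ, σ ∈ U τ ∧ τ.length + c ≤ σ.length}

theorem isMLTest_compressible {U : List Bool →. List Bool} (hU : IsPrefixFreeMachine U) :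
    IsMLTest (compressible U) := by
  constructor
  · have h1 : REPred fun x : (ℕ × List Bool) × List Bool => x.1.2 ∈ U x.2 :=
      (Partrec.graph_re hU.partrec).comp_computable
        (Computable.pair Computable.snd (Computable.snd.comp Computable.fst))
    have h2 : Computable fun x : (ℕ × List Bool) × List Bool =>
        decide (x.2.length + x.1.1 ≤ x.1.2.length) :=
      Primrec.nat_le.decide.to_comp.comp
        (Primrec.nat_add.to_comp.comp (Computable.list_length.comp Computable.snd)
          (Computable.fst.comp Computable.fst))
        (Computable.list_length.comp (Computable.snd.comp Computable.fst))
    refine (h1.and (REPred.of_computable h2)).exists.of_eq fun a => ?_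
    simp [compressible]
  · intro c
    refine (coinMeasure_biUnion_cylinder_le _).trans ?_
    choose τ hτ hle using fun σ : compressible U c => σ.2
    -- A description determines its output, so this map is injective and Kraft's inequality for the
    -- domain of `U` applies, with a factor `2⁻ᶜ` gained.
    let g : compressible U c → {τ | (U τ).Dom} := fun σ => ⟨τ σ, Part.dom_iff_mem.2 ⟨σ, hτ σ⟩⟩
    have hg : Function.Injective g := fun σ σ' h => by
      have h : τ σ = τ σ' := congrArg Subtype.val h
      exact Subtype.ext (Part.mem_unique (hτ σ) (h ▸ hτ σ'))
    calc ∑' σ : compressible U c, (2⁻¹ : ℝ≥0∞) ^ σ.1.length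
        ≤ ∑' σ : compressible U c, 2⁻¹ ^ (g σ).1.length * 2⁻¹ ^ c := by
          refine ENNReal.tsum_le_tsum fun σ => ?_
          rw [← pow_add]
          exact pow_le_pow_right_of_le_one' (by simp) (hle σ)
      _ = (∑' σ : compressible U c, 2⁻¹ ^ (g σ).1.length) * 2⁻¹ ^ c := ENNReal.tsum_mul_right
      _ ≤ 1 * 2⁻¹ ^ c := by
          gcongr
          exact (ENNReal.tsum_comp_le_tsum_of_injective hg
            fun τ : {τ | (U τ).Dom} => (2⁻¹ : ℝ≥0∞) ^ τ.1.length).trans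
              (tsum_prefixFree_le_one fun σ hσ τ hτ => hU.prefixFree σ τ hσ hτ)
      _ = 2⁻¹ ^ c := one_mul _

theorem IsMLRandom.exists_lt_machineComplexity {U : List Bool →. List Bool}
    (hU : IsPrefixFreeMachine U) {X : ℕ → Bool} (hX : IsMLRandom X) :
    ∃ c : ℕ, ∀ n : ℕ, (n : ℕ∞) < machineComplexity U (initSeg X n) + c := by
  by_contra! h
  refine hX _ (isMLTest_compressible hU) (Set.mem_iInter.2 fun c => ?_)
  obtain ⟨n, hn⟩ := h c
  have hle : machineComplexity U (initSeg X n) ≤ n := le_self_add.trans hn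
  obtain ⟨k, hk⟩ := ENat.ne_top_iff_exists.1 (ne_top_of_le_ne_top (ENat.natCast_ne_top n) hle)
  obtain ⟨τ, hτ, hτk⟩ := exists_mem_of_machineComplexity_le hk.ge
  rw [← hk] at hn
  have hn : k + c ≤ n := by exact_mod_cast hn
  refine Set.mem_biUnion (x := initSeg X n) ⟨τ, hτ, ?_⟩ (mem_cylinder_initSeg X n)
  rw [length_initSeg]
  omega

end Deficiency

/-! ### Prefix-free covers from the pointed computation. -/

section PointedCover

/-- Given stages `s` of a test `V`, the strings `ρ` that have length `Φ^ρ(m)`, where `m` is the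
least code of a stage `t` and a length `j` such that `ρ ↾ j` belongs to stage `t` of `V k`. -/
def pointedCover (s : ℕ → ℕ × List Bool → Bool) (Φ : List Bool → ℕ →. ℕ) (k : ℕ) :
    Set (List Bool) :=
  {ρ | ∃ m, m ∈ Nat.rfind (fun m => Part.some (s m.unpair.1 (k, ρ.take m.unpair.2))) ∧
    m ≤ ρ.length ∧ ρ.length ∈ Φ ρ m}

variable {s : ℕ → ℕ × List Bool → Bool} {Φ : List Bool → ℕ →. ℕ} {V : ℕ → Set (List Bool)}
  {k : ℕ}

/-- Codes up to `m` only mention lengths up to `m`, since `m.unpair.2 ≤ m`; the search therefore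
reads at most `m` bits. -/
theorem mem_rfind_take_congr {ρ ρ' : List Bool} {m : ℕ}
    (h : ∀ j ≤ m, ρ.take j = ρ'.take j)
    (hm : m ∈ Nat.rfind fun m => Part.some (s m.unpair.1 (k, ρ.take m.unpair.2))) :
    m ∈ Nat.rfind fun m => Part.some (s m.unpair.1 (k, ρ'.take m.unpair.2)) := by
  obtain ⟨h1, h2⟩ := Nat.mem_rfind.1 hm
  have e : ∀ j ≤ m, s j.unpair.1 (k, ρ.take j.unpair.2) = s j.unpair.1 (k, ρ'.take j.unpair.2) :=
    fun j hj => by rw [h _ ((Nat.unpair_right_le j).trans hj)]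
  exact Nat.mem_rfind.2
    ⟨Part.mem_some_iff.2 ((Part.mem_some_iff.1 h1).trans (e m le_rfl)), fun hj =>
      Part.mem_some_iff.2 ((Part.mem_some_iff.1 (h2 hj)).trans (e _ hj.le))⟩

/-- Because `m ≤ ρ₀.length`, both searches return the same `m`; consistency of `Φ` then makes the
two lengths equal. -/
theorem pointedCover_prefixFree (hΦ : IsTuringFunctional Φ) {ρ₀ ρ₁ : List Bool}
    (h₀ : ρ₀ ∈ pointedCover s Φ k) (h₁ : ρ₁ ∈ pointedCover s Φ k) (h : ρ₀ <+: ρ₁) : ρ₀ = ρ₁ := by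
  obtain ⟨m, hm, hle, hl⟩ := h₀
  obtain ⟨m', hm', -, hl'⟩ := h₁
  have htake : ∀ j ≤ m, ρ₀.take j = ρ₁.take j := fun j hj => by
    obtain ⟨π, rfl⟩ := h
    rw [List.take_append_of_le_length (hj.trans hle)]
  obtain rfl := Part.mem_unique (mem_rfind_take_congr htake hm) hm'
  exact h.eq_of_length (Part.mem_unique (hΦ.consistent _ _ _ _ h hl) hl')

theorem pointedCover_re (hs : Computable₂ s) (hΦ : IsTuringFunctional Φ) :
    REPred fun a : ℕ × List Bool => a.2 ∈ pointedCover s Φ a.1 := by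
  have hf : Partrec fun a : ℕ × List Bool =>
      Nat.rfind fun m => Part.some (s m.unpair.1 (a.1, a.2.take m.unpair.2)) := by
    refine Partrec.rfind (Computable₂.partrec₂ (Computable₂.mk (hs.comp ?_ ?_)))
    · exact Computable.fst.comp (Computable.unpair.comp Computable.snd)
    · exact Computable.pair (Computable.fst.comp Computable.fst)
        (Primrec.list_take.to_comp.comp
          (Computable.snd.comp (Computable.unpair.comp Computable.snd))
          (Computable.snd.comp Computable.fst))
  have hl : Computable fun x : (ℕ × List Bool) × ℕ => x.1.2.length :=
    Computable.list_length.comp (Computable.snd.comp Computable.fst)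
  have h2 : Computable fun x : (ℕ × List Bool) × ℕ => decide (x.2 ≤ x.1.2.length) :=
    Primrec.nat_le.decide.to_comp.comp Computable.snd hl
  have h3 : REPred fun x : (ℕ × List Bool) × ℕ => x.1.2.length ∈ Φ x.1.2 x.2 :=
    (Partrec.graph_re hΦ.partrec).comp_computable (Computable.pair
      (Computable.pair (Computable.snd.comp Computable.fst) Computable.snd) hl)
  refine (hf.graph_re.and ((REPred.of_computable h2).and h3)).exists.of_eq fun a => ?_
  simp only [decide_eq_true_eq]
  rfl

variable (hsV : ∀ a : ℕ × List Bool, a.2 ∈ V a.1 ↔ ∃ t, s t a = true)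

include hsV

theorem biUnion_pointedCover_subset :
    ⋃ ρ ∈ pointedCover s Φ k, cylinder ρ ⊆ ⋃ σ ∈ V k, cylinder σ := by
  refine Set.iUnion₂_subset fun ρ hρ => ?_
  obtain ⟨m, hm, -, -⟩ := hρ
  have h := Nat.rfind_spec hm
  rw [Part.mem_some_iff] at h
  exact (cylinder_anti (List.take_prefix _ _)).trans
    (Set.subset_biUnion_of_mem (u := cylinder) ((hsV (k, ρ.take m.unpair.2)).2 ⟨_, h.symm⟩))

theorem exists_initSeg_mem_pointedCover {X : ℕ → Bool} {r : ℕ → ℕ} (hr : StrictMono r)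
    (hrΦ : ∀ n, r n ∈ Φ (initSeg X (r n)) n) (hX : X ∈ ⋃ σ ∈ V k, cylinder σ) :
    ∃ n, initSeg X (r n) ∈ pointedCover s Φ k := by
  obtain ⟨σ, hσ, hXσ⟩ := Set.mem_iUnion₂.1 hX
  obtain ⟨t, ht⟩ := (hsV (k, σ)).1 hσ
  let N := Nat.pair t σ.length
  have hN : s N.unpair.1 (k, (initSeg X N).take N.unpair.2) = true := by
    rw [take_initSeg X (Nat.unpair_right_le N), Nat.unpair_pair,
      initSeg_mem_of_mem_cylinder hXσ]
    exact ht
  obtain ⟨m, hm, hmN⟩ := Nat.rfind_min' (p := fun m =>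
    s m.unpair.1 (k, (initSeg X N).take m.unpair.2)) hN
  -- The code `m` itself serves as the index: `m ≤ r m`, so `X ↾ r m` is long enough to rerun the
  -- search.
  refine ⟨m, m, mem_rfind_take_congr (fun j hj => ?_) hm, ?_, ?_⟩
  · rw [take_initSeg X (hj.trans hmN), take_initSeg X (hj.trans (hr.le_apply))]
  · simpa using hr.le_apply
  · simpa using hrΦ m

end PointedCover

/-! ### Randomness from incompressibility along `r`. -/

theorem isMLRandom_of_lt_machineComplexity {U : List Bool →. List Bool}
    (hU : IsOptimalPrefixFreeMachine U) {X : ℕ → Bool} {r : ℕ → ℕ}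
    (hr : IsPointedlyComputable X r) {c : ℕ}
    (hc : ∀ n, (r n : ℕ∞) < machineComplexity U (initSeg X (r n)) + c) : IsMLRandom X := by
  intro V hV hX
  obtain ⟨hmono, Φ, hΦ, hrΦ⟩ := hr
  obtain ⟨s, hs, -, -, hsV⟩ := hV.1.exists_stages
  -- Shortening by `k` bits multiplies the weight by `2 ^ k`; level `2k + 2` leaves `2⁻ᵏ / 4`, with
  -- sum `1/2`.
  let R : ℕ → Set (List Bool) := fun k => pointedCover s Φ (2 * k + 2)
  have hRpf : ∀ k, ∀ σ ∈ R k, ∀ τ ∈ R k, σ <+: τ → σ = τ := fun k σ hσ τ hτ =>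
    pointedCover_prefixFree hΦ hσ hτ
  have hRμ : ∀ k, ∑' ρ : R k, (2⁻¹ : ℝ≥0∞) ^ ρ.1.length ≤ 2⁻¹ ^ (2 * k + 2) := fun k => by
    rw [tsum_prefixFree_eq_coinMeasure (hRpf k)]
    exact (MeasureTheory.measure_mono (biUnion_pointedCover_subset hsV)).trans (hV.2 _)
  let Q : Set (ℕ × List Bool) := {q | ∃ k, q.2 ∈ R k ∧ q.1 + k = q.2.length}
  have hQ : REPred fun q => q ∈ Q := by
    have h1 : REPred fun x : (ℕ × List Bool) × ℕ => x.1.2 ∈ R x.2 :=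
      (pointedCover_re hs hΦ).comp_computable (Computable.pair
        (Computable.succ.comp (Computable.succ.comp
          (Primrec.nat_mul.to_comp.comp (Computable.const 2) Computable.snd)))
        (Computable.snd.comp Computable.fst))
    have h2 : Computable fun x : (ℕ × List Bool) × ℕ => decide (x.1.1 + x.2 = x.1.2.length) :=
      Primrec.eq.decide.to_comp.comp
        (Primrec.nat_add.to_comp.comp (Computable.fst.comp Computable.fst) Computable.snd)
        (Computable.list_length.comp (Computable.snd.comp Computable.fst))
    refine (h1.and (REPred.of_computable h2)).exists.of_eq fun a => ?_
    simp only [decide_eq_true_eq]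
    rfl
  have hw : ∑' q : Q, (2⁻¹ : ℝ≥0∞) ^ q.1.1 ≤ 2⁻¹ := by
    choose k hkR hk using fun q : Q => q.2
    let g : Q → Σ k, R k := fun q => ⟨k q, q.1.2, hkR q⟩
    have hg : Function.Injective g := fun q q' h => by
      have h1 : k q = k q' := congrArg Sigma.fst h
      have h2 : q.1.2 = q'.1.2 := congrArg (fun x : Σ k, R k => x.2.1) h
      have h3 := hk q
      rw [h1, h2, ← hk q'] at h3
      exact Subtype.ext (Prod.ext (Nat.add_right_cancel h3) h2)
    have hpow : ∀ n : ℕ, (2 : ℝ≥0∞) ^ n * 2⁻¹ ^ n = 1 := fun n => by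
      rw [← mul_pow, ENNReal.mul_inv_cancel (by simp) (by simp), one_pow]
    calc ∑' q : Q, (2⁻¹ : ℝ≥0∞) ^ q.1.1
        = ∑' q : Q, 2 ^ (g q).1 * 2⁻¹ ^ (g q).2.1.length := by
          refine tsum_congr fun q => ?_
          change _ = 2 ^ k q * 2⁻¹ ^ q.1.2.length
          rw [← hk q, add_comm, pow_add, ← mul_assoc, hpow, one_mul]
      _ ≤ ∑' x : Σ k, R k, (2 : ℝ≥0∞) ^ x.1 * 2⁻¹ ^ x.2.1.length :=
          ENNReal.tsum_comp_le_tsum_of_injective hg _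
      _ = ∑' k, (2 : ℝ≥0∞) ^ k * ∑' ρ : R k, 2⁻¹ ^ ρ.1.length := by
          rw [ENNReal.tsum_sigma']
          simp_rw [ENNReal.tsum_mul_left]
      _ ≤ ∑' k : ℕ, 2⁻¹ ^ k * 2⁻¹ ^ 2 := by
          refine ENNReal.tsum_le_tsum fun k => ?_
          refine (mul_le_mul_right (hRμ k) _).trans_eq ?_
          rw [two_mul, pow_add, pow_add, ← mul_assoc, ← mul_assoc, hpow, one_mul]
      _ = 2⁻¹ := by
          rw [ENNReal.tsum_mul_right, ENNReal.tsum_geometric, ENNReal.one_sub_inv_two, inv_inv,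
            pow_two, ← mul_assoc, ENNReal.mul_inv_cancel (by simp) (by simp), one_mul]
  obtain ⟨M, hM, hMQ⟩ := exists_prefixFreeMachine hQ hw
  obtain ⟨d, hd⟩ := hU.optimal M hM
  let k := c + d
  obtain ⟨n, hn⟩ := exists_initSeg_mem_pointedCover hsV hmono hrΦ
    (Set.mem_iInter.1 hX (2 * k + 2))
  -- A single member of `R k` weighs at most `2⁻¹ ^ (2 * k + 2)`, so it is long and `r n - k` is not
  -- truncated.
  have hkn : k ≤ r n := by
    have h := (ENNReal.le_tsum (f := fun ρ : R k => (2⁻¹ : ℝ≥0∞) ^ ρ.1.length)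
      ⟨_, hn⟩).trans (hRμ k)
    simp only [length_initSeg] at h
    rw [← ENNReal.inv_pow, ← ENNReal.inv_pow, ENNReal.inv_le_inv] at h
    have h : 2 ^ (2 * k + 2) ≤ 2 ^ r n := by exact_mod_cast h
    have := (Nat.pow_le_pow_iff_right (by norm_num)).1 h
    omega
  have hK : machineComplexity U (initSeg X (r n)) ≤ ((r n - k + d : ℕ) : ℕ∞) := by
    refine (hd _).trans ?_
    push_cast
    gcongr
    have hlen : r n - k + k = (initSeg X (r n)).length := by
      rw [length_initSeg, Nat.sub_add_cancel hkn]
    exact_mod_cast hMQ (r n - k) _ ⟨k, hn, hlen⟩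
  have h := (hc n).trans_le (add_le_add_left hK _)
  have h : r n < r n - k + d + c := by exact_mod_cast h
  omega

theorem theorem1 (U : List Bool →. List Bool) (hU : IsOptimalPrefixFreeMachine U)
    (X : ℕ → Bool) (r : ℕ → ℕ) (hr : IsPointedlyComputable X r) :
    IsMLRandom X ↔
      ∃ c : ℕ, ∀ n, (r n : ℕ∞) < machineComplexity U (initSeg X (r n)) + c := by
  constructor
  · intro hX
    obtain ⟨c, hc⟩ := hX.exists_lt_machineComplexity hU.isPrefixFreeMachine
    exact ⟨c, fun n => hc (r n)⟩
  · rintro ⟨c, hc⟩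
    exact isMLRandom_of_lt_machineComplexity hU hr hc
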